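/- **Setting.** A job $j$ has a release time $r_j\in\mathbb R$, a deadline $d_j\in\mathbb R$ and a processing time $p_j>0$ with $p_j\le d_j-r_j$. Given a finite set $J$ of jobs, a schedule assigns to each job a start time $s_j\in[r_j,d_j-p_j]$ and one of infinitely many identical machines, on which the job runs without preemption during $[s_j,s_j+p_j)$; at any time at most $g$ jobs may run on the same machine ($g=\infty$: no restriction). The span of a machine is the Lebesgue measure of the set of times at which it runs at least one job, and the busy time (cost) of a schedule is the sum of the spans of all machines. $OPT_g(J)$ is the infimum of the busy times of all feasible schedules of $J$. An online algorithm with lookahead $\ell$ learns of job $j$ at time $r_j-\ell$, and its decisions up to time $t$ depend only on the jobs revealed up to time $t$; it is $c$-competitive for parallelism $g$ if on every finite instance $J$ it produces a feasible schedule of busy time at most $c\cdot OPT_g(J)$. Let $p_{\max}=\max_{j\in J}p_j$. **Theorem.** For every integer $g\ge 1$ there is a $9$-competitive deterministic online algorithm with lookahead $p_{\max}$ for busy time scheduling of flexible jobs with arbitrary processing times and parallelism $g$. Such an algorithm can be obtained in two stages. There is a $5$-competitive online algorithm without lookahead for unbounded parallelism $g=\infty$. Moreover, for every such algorithm $F$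 there is a $9$-competitive online algorithm $A$ with lookahead $p_{\max}$ for parallelism $g$ which runs every job at the start time chosen by $F$ (so that the jobs are fixed as rigid jobs) and assigns the rigid jobs to machines (bundles) $B_1,B_2,\dots$, each of parallelism at most $g$, in such a way that, on every instance $J$, $$Sp(B_1)\le 5\cdot OPT_\infty(J)\qquad\text{and}\qquad \sum_{i>1}Sp(B_i)\le 4\cdot OPT_g(J),$$ where $Sp(B_i)$ is the span of machine $i$. -/

import Mathlib

open scoped ENNReal

noncomputable section

namespace BusyTime

/-- A flexible job: release time, deadline and (positive) processing time, such that the job fits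
between its release time and its deadline. -/
structure Job where
  release : ℝ
  deadline : ℝ
  proc : ℝ
  proc_pos : 0 < proc
  fits : proc ≤ deadline - release

/-- A finite instance: a finite set of job names, and the job that carries each of these names.
Distinct names may carry identical jobs; the values of `job` outside `names` play no role. -/
structure Instance where
  names : Finset ℕ
  job : ℕ → Job

/-- The largest processing time of the instance (`0` for the instance without jobs). -/
def pmax (I : Instance) : ℝ := sSup ((fun j => (I.job j).proc) '' (I.names : Set ℕ))

/-- A schedule gives every job a start time and a machine. There are infinitely many machines. -/
structure Schedule where
  start : ℕ → ℝ
  machine : ℕ → ℕ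

/-- The half-open interval in which job `j` is processed. -/
def runInterval (I : Instance) (S : Schedule) (j : ℕ) : Set ℝ :=
  Set.Ico (S.start j) (S.start j + (I.job j).proc)

/-- A schedule is feasible for parallelism `g` (with `g = ⊤` for unbounded parallelism) if every job
runs without preemption between its release time and its deadline, and at no time more than `g`
jobs run on the same machine. -/
def Feasible (g : ℕ∞) (I : Instance) (S : Schedule) : Prop :=
  (∀ j ∈ I.names, (I.job j).release ≤ S.start j ∧
      S.start j + (I.job j).proc ≤ (I.job j).deadline) ∧
  ∀ (i : ℕ) (t : ℝ), {j | j ∈ I.names ∧ S.machine j = i ∧ t ∈ runInterval I S j}.encard ≤ g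

/-- The span of machine `i`: the Lebesgue measure of the times at which it runs some job. -/
def machineSpan (I : Instance) (S : Schedule) (i : ℕ) : ℝ≥0∞ :=
  MeasureTheory.volume (⋃ j ∈ {j | j ∈ I.names ∧ S.machine j = i}, runInterval I S j)

/-- The busy time of a schedule: the sum of the spans of all machines. -/
def busyTime (I : Instance) (S : Schedule) : ℝ≥0∞ := ∑' i : ℕ, machineSpan I S i

/-- The optimal (offline) busy time. -/
def OPT (g : ℕ∞) (I : Instance) : ℝ≥0∞ :=
  ⨅ (S : Schedule) (_ : Feasible g I S), busyTime I S

/-- Everything revealed up to and including time `t` when the lookahead is `l`: for each job `j`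
with `r_j - l ≤ t`, the time `r_j - l` at which it was revealed, its name, and the job itself. -/
def history (l : ℝ) (I : Instance) (t : ℝ) : Set (ℝ × ℕ × Job) :=
  {x | x.1 ≤ t ∧ ∃ j ∈ I.names, x = ((I.job j).release - l, j, I.job j)}

/-- A (deterministic) scheduling algorithm, which produces a schedule for every instance, is online
with lookahead `l` (which may depend on the instance) if its decisions up to each time `t` depend
only on what has been revealed up to time `t`: when two instances have the same history up to `t`,
every job that is started up to time `t` in the one is started at the same time and on the same
machine in the other. -/
def IsOnline (l : Instance → ℝ) (A : Instance → Schedule) : Prop :=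
  ∀ (I I' : Instance) (t : ℝ), history (l I) I t = history (l I') I' t →
    ∀ j ∈ I.names, (A I).start j ≤ t →
      (A I').start j = (A I).start j ∧ (A I').machine j = (A I).machine j

/-- `A` is a `c`-competitive online algorithm for busy time scheduling with parallelism `g` and
lookahead `l`. -/
def IsCompetitive (g : ℕ∞) (l : Instance → ℝ) (c : ℝ≥0∞) (A : Instance → Schedule) : Prop :=
  IsOnline l A ∧ ∀ I : Instance, Feasible g I (A I) ∧ busyTime I (A I) ≤ c * OPT g I

end BusyTime

end

/-!
For unbounded parallelism only the start times matter. The doubling algorithm (`doubler`) waits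
until some job has to be started, a *flag*, of latest start time `u` and processing time `p`; it
then opens the window `[u, u + 2p)`, and every job that can complete inside the window is started in
it. Let `O` be the set of times at which some job runs in an arbitrary feasible schedule. Windows
inside `O` cost at most `|O|`. Let two flags, run in the same component of `O`, have windows that
leave `O`. The later one did not join the window of the earlier one, which means that it is more
than twice as long, or is released so late that it completes only after that window; the latter is
impossible, as it would put the whole end of the window into `O`. So the flags of a component that
have such windows grow geometrically, the last of them fits into the component, and these windows
cost at most four times the component: `busyTime_doubler_le` gives `|O| + 4 |O|`.

For parallelism `g` the start times of an algorithm `F` for unbounded parallelism are kept, and the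
resulting rigid jobs are put by first fit onto tracks of pairwise disjoint jobs, `g` consecutive
tracks making up one machine (`bundle`). The jobs are treated by decreasing size class,
`p_max / 2 ^ (k + 1) < p ≤ p_max / 2 ^ k`, and by start time within a class. A job on machine `m + 1` is blocked
on every track of machine `m` by an overlapping job `i` treated before it, which is longer, or is
more than half as long and starts no later; so it lies within `[s_i - p_i, s_i + 3 p_i)`. Hence the
span of machine `m + 1` is at most four times the length of each of the `g` tracks of machine `m`,
that is, at most `4 / g` times the load of this machine, and the loads add up to at most
`g * OPT g I` (`sum_proc_le_mul_OPT`). The first machine costs no more than the schedule of `F`.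

First fit in this order is online with lookahead `p_max`: the track of a job depends only on
overlapping jobs of its class that start earlier and on overlapping jobs of larger classes, so that
a chain of dependences moves to the right by at most `p_max / 2 ^ k + ... + p_max / 2 < p_max`
(`track_congr`).
-/

noncomputable section

namespace BusyTime

open MeasureTheory

/-! ### Lower bounds for the busy time -/

theorem volume_runInterval (I : Instance) (S : Schedule) (j : ℕ) :
    volume (runInterval I S j) = ENNReal.ofReal (I.job j).proc := by
  simp [runInterval]

theorem tsum_sum_filter_eq (N : Finset ℕ) (f : ℕ → ℕ) (w : ℕ → ℝ≥0∞) :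
    ∑' i, ∑ j ∈ N with f j = i, w j = ∑ j ∈ N, w j := by
  simp_rw [Finset.sum_filter]
  rw [Summable.tsum_finsetSum fun _ _ => ENNReal.summable]
  refine Finset.sum_congr rfl fun j _ => ?_
  rw [tsum_eq_single (f j) (fun i hi => if_neg hi.symm), if_pos rfl]

theorem volume_biUnion_runInterval_le_busyTime (I : Instance) (S : Schedule) :
    volume (⋃ j ∈ I.names, runInterval I S j) ≤ busyTime I S := by
  refine le_trans (measure_mono ?_) (measure_iUnion_le fun i =>
    ⋃ j ∈ {j | j ∈ I.names ∧ S.machine j = i}, runInterval I S j)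
  intro x hx
  simp only [Set.mem_iUnion, Set.mem_ofPred_eq] at hx ⊢
  obtain ⟨j, hj, hx⟩ := hx
  exact ⟨_, j, ⟨hj, rfl⟩, hx⟩

theorem machineSpan_le_volume (I : Instance) (S : Schedule) (i : ℕ) :
    machineSpan I S i ≤ volume (⋃ j ∈ I.names, runInterval I S j) := by
  refine measure_mono (Set.iUnion₂_subset fun j hj => ?_)
  exact Set.subset_iUnion₂ (s := fun j (_ : j ∈ I.names) => runInterval I S j) j hj.1

/-- At most `g` jobs run on a machine at a time, so its load is at most `g` times its span. -/
theorem sum_proc_le_mul_machineSpan {g : ℕ} {I : Instance} {S : Schedule}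
    (hS : Feasible g I S) (i : ℕ) :
    ∑ j ∈ I.names with S.machine j = i, ENNReal.ofReal (I.job j).proc ≤
      g * machineSpan I S i := by
  classical
  have hmeas : ∀ j, MeasurableSet (runInterval I S j) := fun j => measurableSet_Ico
  set U : Set ℝ := ⋃ j ∈ {j | j ∈ I.names ∧ S.machine j = i}, runInterval I S j with hU
  have hUm : MeasurableSet U :=
    MeasurableSet.biUnion (Set.to_countable _) fun j _ => hmeas j
  calc ∑ j ∈ I.names with S.machine j = i, ENNReal.ofReal (I.job j).proc
      = ∑ j ∈ I.names with S.machine j = i,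
          ∫⁻ x, (runInterval I S j).indicator (fun _ => (1 : ℝ≥0∞)) x := by
        refine Finset.sum_congr rfl fun j _ => ?_
        rw [lintegral_indicator_const (hmeas j), one_mul, volume_runInterval]
    _ = ∫⁻ x, ∑ j ∈ I.names with S.machine j = i,
          (runInterval I S j).indicator (fun _ => (1 : ℝ≥0∞)) x := by
        rw [lintegral_finsetSum _ fun j _ => measurable_const.indicator (hmeas j)]
    _ ≤ ∫⁻ x, U.indicator (fun _ => (g : ℝ≥0∞)) x := by
        refine lintegral_mono fun x => ?_
        by_cases hx : x ∈ U
        · simp only [Set.indicator_apply, hx, if_true]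
          rw [← Finset.sum_filter, Finset.sum_const, nsmul_one]
          have := hS.2 i x
          have hset : {j | j ∈ I.names ∧ S.machine j = i ∧ x ∈ runInterval I S j} =
              (({j ∈ {j ∈ I.names | S.machine j = i} | x ∈ runInterval I S j} :
                Finset ℕ) : Set ℕ) := by
            ext j; simp [and_assoc]
          rw [hset, Set.encard_coe_eq_coe_finsetCard] at this
          exact_mod_cast this
        · rw [Set.indicator_of_notMem hx]
          refine (Finset.sum_eq_zero fun j hj => Set.indicator_of_notMem (fun hxj => hx ?_) _).le
          simp only [Finset.mem_filter] at hj
          exact Set.mem_biUnion (show j ∈ {j | j ∈ I.names ∧ S.machine j = i} from hj) hxj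
    _ = g * machineSpan I S i := by rw [lintegral_indicator_const hUm]; rfl

theorem le_mul_OPT {g : ℕ∞} {I : Instance} {a c : ℝ≥0∞} (hc : c ≠ 0) (hc' : c ≠ ⊤)
    (h : ∀ S, Feasible g I S → a ≤ c * busyTime I S) : a ≤ c * OPT g I := by
  simp only [OPT, ENNReal.mul_iInf_of_ne hc hc', le_iInf_iff]
  exact h

theorem sum_proc_le_mul_OPT {g : ℕ} (hg : 1 ≤ g) (I : Instance) :
    ∑ j ∈ I.names, ENNReal.ofReal (I.job j).proc ≤ g * OPT g I := by
  refine le_mul_OPT (Nat.cast_ne_zero.2 (by omega)) (ENNReal.natCast_ne_top g) fun S hS => ?_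
  rw [← tsum_sum_filter_eq I.names S.machine, busyTime, ← ENNReal.tsum_mul_left]
  exact ENNReal.tsum_le_tsum (sum_proc_le_mul_machineSpan hS)

theorem OPT_top_le (g : ℕ∞) (I : Instance) : OPT ⊤ I ≤ OPT g I :=
  le_iInf₂ fun S hS => iInf₂_le S ⟨hS.1, fun _ _ => le_top⟩

/-! ### Histories and recursion along a finite order -/

/-- A revealed job is revealed with its release time and the time of its revelation, so that a
history that is not empty determines the lookahead. -/
theorem mem_of_history_eq {l l' t : ℝ} {I I' : Instance}
    (h : history l I t = history l' I' t) {j : ℕ} (hj : j ∈ I.names)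
    (ht : (I.job j).release - l ≤ t) :
    j ∈ I'.names ∧ I'.job j = I.job j ∧ l' = l := by
  have : ((I.job j).release - l, j, I.job j) ∈ history l' I' t := by
    rw [← h]; exact ⟨ht, j, hj, rfl⟩
  obtain ⟨-, i, hi, he⟩ := this
  simp only [Prod.mk.injEq] at he
  obtain ⟨h1, rfl, h2⟩ := he
  rw [← h2] at h1
  exact ⟨hi, h2.symm, by linarith⟩

/-- `i` is one of the names in `N` and comes before `j` in the order given by `key`. -/
def Earlier {κ : Type*} [LT κ] (N : Finset ℕ) (key : ℕ → κ) (i j : ℕ) : Prop :=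
  i ∈ N ∧ key i < key j

theorem wellFounded_earlier {κ : Type*} [Preorder κ] (N : Finset ℕ) (key : ℕ → κ) :
    WellFounded (Earlier N key) := by
  classical
  refine Subrelation.wf (fun {i j} h => ?_)
    (measure fun j => (N.filter fun k => key k < key j).card).wf
  refine Finset.card_lt_card ⟨fun k hk => ?_, fun hsub => ?_⟩
  · simp only [Finset.mem_filter] at hk ⊢
    exact ⟨hk.1, hk.2.trans h.2⟩
  · have := hsub (Finset.mem_filter.2 h)
    exact lt_irrefl _ (Finset.mem_filter.1 this).2

/-! ### The doubling algorithm for unbounded parallelism -/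

/-- The latest time at which a job can be started. -/
def latestStart (J : Job) : ℝ := J.deadline - J.proc

theorem release_le_latestStart (J : Job) : J.release ≤ latestStart J := by
  have := J.fits
  unfold latestStart; linarith

/-- If `K` is started at its latest start time `u`, it opens the window `[u, u + 2 p)`, where `p` is
the processing time of `K`; the job `J` joins it if `J` still completes inside this window when it
is started as soon as it is released and the window is open. -/
def Joins (K J : Job) : Prop :=
  max J.release (latestStart K) + J.proc ≤ latestStart K + 2 * K.proc

/-- Jobs in the order of their latest start times, ties being broken by their names. -/
def urgency (I : Instance) (j : ℕ) : ℝ ×ₗ ℕ := toLex (latestStart (I.job j), j)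

theorem latestStart_le_of_urgency_lt {I : Instance} {i j : ℕ} (h : urgency I i < urgency I j) :
    latestStart (I.job i) ≤ latestStart (I.job j) := by
  rcases Prod.Lex.toLex_lt_toLex.1 h with h | h
  · exact h.le
  · exact h.1.le

/-- A job is a flag if it does not join the window of any earlier flag. The flags are the jobs which
the doubling algorithm starts because their latest start time has come. -/
def IsFlag (I : Instance) : ℕ → Prop :=
  (wellFounded_earlier I.names (urgency I)).fix fun j flag =>
    ∀ i (h : Earlier I.names (urgency I) i j), flag i h → ¬ Joins (I.job i) (I.job j)

theorem isFlag_iff (I : Instance) (j : ℕ) :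
    IsFlag I j ↔ ∀ i, Earlier I.names (urgency I) i j → IsFlag I i →
      ¬ Joins (I.job i) (I.job j) := by
  conv_lhs => rw [IsFlag, WellFounded.fix_eq]
  rfl

/-- The doubling algorithm: every job is started as soon as possible in a window which it joins. -/
def doubler (I : Instance) : Schedule where
  start j := sInf ((fun i => max (I.job j).release (latestStart (I.job i))) ''
    {i | i ∈ I.names ∧ IsFlag I i ∧ Joins (I.job i) (I.job j)})
  machine _ := 0

theorem exists_flag_joins {I : Instance} {j : ℕ} (hj : j ∈ I.names) :
    ∃ i ∈ I.names, IsFlag I i ∧ Joins (I.job i) (I.job j) ∧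
      latestStart (I.job i) ≤ latestStart (I.job j) := by
  by_cases h : IsFlag I j
  · refine ⟨j, hj, h, ?_, le_rfl⟩
    have := (I.job j).proc_pos
    rw [Joins, max_eq_right (release_le_latestStart _)]
    linarith
  · rw [isFlag_iff] at h
    push Not at h
    obtain ⟨i, hi, hf, hJ⟩ := h
    exact ⟨i, hi.1, hf, hJ, latestStart_le_of_urgency_lt hi.2⟩

/-- This holds for every flag `i` whose window `j` can join, also for one that comes after `j`. -/
theorem doubler_start_le {I : Instance} {i j : ℕ} (hi : i ∈ I.names) (hf : IsFlag I i)
    (hJ : Joins (I.job i) (I.job j)) :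
    (doubler I).start j ≤ max (I.job j).release (latestStart (I.job i)) :=
  csInf_le (((I.names.finite_toSet.subset fun _ h => h.1).image _).bddBelow)
    ⟨i, ⟨hi, hf, hJ⟩, rfl⟩

theorem exists_doubler_start_eq {I : Instance} {j : ℕ} (hj : j ∈ I.names) :
    ∃ i ∈ I.names, IsFlag I i ∧ Joins (I.job i) (I.job j) ∧
      (doubler I).start j = max (I.job j).release (latestStart (I.job i)) := by
  obtain ⟨i, hi, hf, hJ, -⟩ := exists_flag_joins hj
  obtain ⟨k, ⟨hk, hkf, hkJ⟩, he⟩ := Set.Nonempty.csInf_mem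
    (s := (fun i => max (I.job j).release (latestStart (I.job i))) ''
      {i | i ∈ I.names ∧ IsFlag I i ∧ Joins (I.job i) (I.job j)})
    ⟨_, i, ⟨hi, hf, hJ⟩, rfl⟩ ((I.names.finite_toSet.subset fun _ h => h.1).image _)
  exact ⟨k, hk, hkf, hkJ, he.symm⟩

theorem doubler_feasible (I : Instance) : Feasible ⊤ I (doubler I) := by
  refine ⟨fun j hj => ⟨?_, ?_⟩, fun _ _ => le_top⟩
  · obtain ⟨i, -, -, -, he⟩ := exists_doubler_start_eq hj
    rw [he]; exact le_max_left _ _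
  · obtain ⟨i, hi, hf, hJ, hu⟩ := exists_flag_joins hj
    have h := (doubler_start_le hi hf hJ).trans (max_le (release_le_latestStart _) hu)
    unfold latestStart at h; linarith

/-- Whether a job is a flag depends only on jobs with no later latest start time, all of which have
been released by then. -/
theorem isFlag_congr {I I' : Instance} {t : ℝ} (h : history 0 I t = history 0 I' t) (j : ℕ)
    (hj : j ∈ I.names) (ht : latestStart (I.job j) ≤ t) : IsFlag I j ↔ IsFlag I' j := by
  have key : ∀ {I I' : Instance}, history 0 I t = history 0 I' t → ∀ i ∈ I.names,
      latestStart (I.job i) ≤ t → i ∈ I'.names ∧ I'.job i = I.job i := fun h i hi ht => by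
    have := mem_of_history_eq h hi (by rw [sub_zero]; exact (release_le_latestStart _).trans ht)
    exact ⟨this.1, this.2.1⟩
  induction j using (wellFounded_earlier I.names (urgency I)).induction with
  | _ j ih =>
    obtain ⟨hj', hjob⟩ := key h j hj ht
    rw [isFlag_iff, isFlag_iff]
    refine forall_congr' fun i => ?_
    have hE : Earlier I.names (urgency I) i j ↔ Earlier I'.names (urgency I') i j := by
      constructor
      · intro hi
        obtain ⟨hi', hijob⟩ := key h i hi.1 ((latestStart_le_of_urgency_lt hi.2).trans ht)
        refine ⟨hi', ?_⟩
        have := hi.2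
        simpa only [urgency, hjob, hijob] using this
      · intro hi
        have hi2 := latestStart_le_of_urgency_lt hi.2
        rw [hjob] at hi2
        obtain ⟨hi', hijob⟩ := key h.symm i hi.1 (hi2.trans ht)
        refine ⟨hi', ?_⟩
        have := hi.2
        simpa only [urgency, hjob, hijob] using this
    rw [← hE]
    refine forall_congr' fun hi => ?_
    have hit := (latestStart_le_of_urgency_lt hi.2).trans ht
    have hf : IsFlag I i ↔ IsFlag I' i := ih i hi hi.1 hit
    rw [hf, (key h i hi.1 hit).2, hjob]

theorem doubler_isOnline : IsOnline (fun _ => 0) doubler := by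
  intro I I' t h j hj ht
  refine ⟨?_, rfl⟩
  have hrel : (I.job j).release ≤ t := ((doubler_feasible I).1 j hj).1.trans ht
  obtain ⟨hj', hjob, -⟩ := mem_of_history_eq h hj (by simpa using hrel)
  have key : ∀ {I I' : Instance}, history 0 I t = history 0 I' t → j ∈ I.names →
      I'.job j = I.job j → (doubler I).start j ≤ t →
      (doubler I').start j ≤ (doubler I).start j := by
    intro I I' h hj hjob ht
    obtain ⟨i, hi, hf, hJ, he⟩ := exists_doubler_start_eq hj
    have hit : latestStart (I.job i) ≤ t := (le_max_right _ _).trans (he ▸ ht)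
    obtain ⟨hi', hijob, -⟩ := mem_of_history_eq h hi
      (by rw [sub_zero]; exact (release_le_latestStart _).trans hit)
    rw [he, ← hjob, ← hijob]
    exact doubler_start_le hi' ((isFlag_congr h i hi hit).1 hf) (by rwa [hjob, hijob])
  have hle := key h hj hjob ht
  exact le_antisymm hle (key h.symm hj' hjob.symm (hle.trans ht))

/-- The bound `2` comes from the geometric series: ordered by size, each term is less than half of
the next one. -/
theorem exists_sum_le_two_mul {ι : Type*} (S : Finset ι) (p : ι → ℝ) (hS : S.Nonempty)
    (hp : ∀ i ∈ S, 0 < p i)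
    (h : ∀ i ∈ S, ∀ j ∈ S, i ≠ j → 2 * p i < p j ∨ 2 * p j < p i) :
    ∃ m ∈ S, ∑ i ∈ S, p i ≤ 2 * p m := by
  classical
  induction S using Finset.induction_on_max_value p with
  | empty => exact absurd hS Finset.not_nonempty_empty
  | insert a s ha hmax ih =>
    refine ⟨a, Finset.mem_insert_self _ _, ?_⟩
    rw [Finset.sum_insert ha]
    have hpa := hp a (Finset.mem_insert_self _ _)
    rcases s.eq_empty_or_nonempty with rfl | hs
    · simp only [Finset.sum_empty]; linarith
    · obtain ⟨m, hm, hsum⟩ := ih hs (fun i hi => hp i (Finset.mem_insert_of_mem hi))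
        fun i hi j hj => h i (Finset.mem_insert_of_mem hi) j (Finset.mem_insert_of_mem hj)
      have h1 := hmax m hm
      rcases h m (Finset.mem_insert_of_mem hm) a (Finset.mem_insert_self _ _)
        (fun hma => ha (hma ▸ hm)) with h2 | h2 <;> linarith

/-- Intervals inside `O` are given, each with a point `x i` outside `O` to its right, such that the
lengths of any two of them differ by a factor of more than two, unless one of these points separates
them. Intervals in the same component of `O` have geometrically growing lengths, so that their total
length is at most twice that of the longest one. -/
theorem sum_length_le_two_mul_volume (B : Finset ℕ) (o p x : ℕ → ℝ) (O : Set ℝ)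
    (hp : ∀ i ∈ B, 0 < p i) (hO : ∀ i ∈ B, Set.Ico (o i) (o i + p i) ⊆ O)
    (hx : ∀ i ∈ B, x i ∉ O ∧ o i ≤ x i)
    (h : ∀ i ∈ B, ∀ j ∈ B, i ≠ j →
      (2 * p i < p j ∨ 2 * p j < p i) ∨ (x i < o j ∨ x j < o i)) :
    ∑ i ∈ B, ENNReal.ofReal (p i) ≤ 2 * volume O := by
  classical
  -- `b y` is the right end of the component of `y` in `O`; it serves as a label of the component.
  let b : ℝ → ℝ := fun y => sInf {z | z ∉ O ∧ y ≤ z}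
  have hb : ∀ i ∈ B, ∀ y ∈ Set.Ico (o i) (o i + p i), b y = b (o i) := by
    intro i hi y hy
    change sInf _ = sInf _
    congr 1
    ext z
    refine and_congr_right fun hz => ⟨fun h => hy.1.trans h, fun h => ?_⟩
    by_contra hzy
    exact hz (hO i hi ⟨h, (not_le.1 hzy).trans hy.2⟩)
  have hsep : ∀ i ∈ B, ∀ j ∈ B, x i < o j → b (o i) ≠ b (o j) := by
    intro i hi j hj hij he
    have h1 : b (o i) ≤ x i := csInf_le ⟨o i, fun z hz => hz.2⟩ (hx i hi)
    have h2 : o j ≤ b (o j) := le_csInf ⟨x j, hx j hj⟩ fun z hz => hz.2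
    linarith
  have hfib : ∀ c ∈ B.image (fun i => b (o i)), ∃ m ∈ B, b (o m) = c ∧
      ∑ i ∈ B with b (o i) = c, p i ≤ 2 * p m := by
    intro c hc
    obtain ⟨k, hk, hkc⟩ := Finset.mem_image.1 hc
    obtain ⟨m, hm, hsum⟩ := exists_sum_le_two_mul {i ∈ B | b (o i) = c} p
      ⟨k, Finset.mem_filter.2 ⟨hk, hkc⟩⟩ (fun i hi => hp i (Finset.mem_filter.1 hi).1) (by
        intro i hi j hj hij
        obtain ⟨hi, hic⟩ := Finset.mem_filter.1 hi
        obtain ⟨hj, hjc⟩ := Finset.mem_filter.1 hj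
        rcases h i hi j hj hij with h | h | h
        · exact h
        · exact absurd (hic.trans hjc.symm) (hsep i hi j hj h)
        · exact absurd (hjc.trans hic.symm) (hsep j hj i hi h))
    exact ⟨m, (Finset.mem_filter.1 hm).1, (Finset.mem_filter.1 hm).2, hsum⟩
  choose! m hmB hmc hmsum using hfib
  calc ∑ i ∈ B, ENNReal.ofReal (p i)
      = ∑ c ∈ B.image (fun i => b (o i)), ∑ i ∈ B with b (o i) = c, ENNReal.ofReal (p i) :=
        (Finset.sum_fiberwise_of_maps_to (fun i hi => Finset.mem_image_of_mem _ hi) _).symm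
    _ ≤ ∑ c ∈ B.image (fun i => b (o i)), 2 * volume (Set.Ico (o (m c)) (o (m c) + p (m c))) := by
        refine Finset.sum_le_sum fun c hc => ?_
        rw [← ENNReal.ofReal_sum_of_nonneg fun i hi => (hp i (Finset.mem_filter.1 hi).1).le,
          Real.volume_Ico, add_sub_cancel_left]
        refine (ENNReal.ofReal_le_ofReal (hmsum c hc)).trans_eq ?_
        rw [ENNReal.ofReal_mul zero_le_two, ENNReal.ofReal_ofNat]
    _ = 2 * volume (⋃ c ∈ B.image (fun i => b (o i)),
          Set.Ico (o (m c)) (o (m c) + p (m c))) := by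
        rw [← Finset.mul_sum, measure_biUnion_finset _ fun _ _ => measurableSet_Ico]
        intro c hc d hd hcd
        refine Set.disjoint_left.2 fun y hyc hyd => hcd ?_
        rw [← hmc c hc, ← hmc d hd, ← hb _ (hmB c hc) y hyc, ← hb _ (hmB d hd) y hyd]
    _ ≤ 2 * volume O := by
        gcongr
        exact Set.iUnion₂_subset fun c hc => hO _ (hmB c hc)

/-- The windows of the doubling algorithm have measure at most five times the span `O` of any
feasible schedule: once inside `O`, and four times outside, because the windows that leave `O`
belong to flags of geometrically growing lengths in every component of `O`. -/
theorem busyTime_doubler_le (I : Instance) (S : Schedule) (hS : Feasible ⊤ I S) :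
    busyTime I (doubler I) ≤ 5 * busyTime I S := by
  classical
  set O : Set ℝ := ⋃ j ∈ I.names, runInterval I S j with hOdef
  let W : ℕ → Set ℝ := fun i =>
    Set.Ico (latestStart (I.job i)) (latestStart (I.job i) + 2 * (I.job i).proc)
  set B : Finset ℕ := {i ∈ I.names | IsFlag I i ∧ ¬ W i ⊆ O} with hB
  have hBm : ∀ i ∈ B, i ∈ I.names ∧ IsFlag I i ∧ ¬ W i ⊆ O := fun i hi => Finset.mem_filter.1 hi
  have hrun : ∀ j ∈ I.names, runInterval I S j ⊆ O := fun j hj =>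
    Set.subset_iUnion₂ (s := fun j (_ : j ∈ I.names) => runInterval I S j) j hj
  have hsum : ∑ i ∈ B, ENNReal.ofReal (I.job i).proc ≤ 2 * volume O := by
    have hx : ∀ i, ∃ x, i ∈ B → x ∈ W i ∧ x ∉ O := by
      intro i
      by_cases hi : i ∈ B
      · obtain ⟨x, hx⟩ := Set.not_subset.1 (hBm i hi).2.2
        exact ⟨x, fun _ => hx⟩
      · exact ⟨0, fun h => absurd h hi⟩
    choose x hx using hx
    -- A flag that did not join the window of `i` because it was released too late completes after
    -- `x i`; as `x i` is not in `O`, it also starts after `x i`.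
    have hpair : ∀ i ∈ B, ∀ j ∈ B, urgency I i < urgency I j →
        2 * (I.job i).proc < (I.job j).proc ∨ x i < S.start j := by
      intro i hi j hj hij
      have hnj := (isFlag_iff I j).1 (hBm j hj).2.1 i ⟨(hBm i hi).1, hij⟩ (hBm i hi).2.1
      rw [Joins, not_le] at hnj
      rcases le_total (I.job j).release (latestStart (I.job i)) with hr | hr
      · rw [max_eq_right hr] at hnj
        left; linarith
      · rw [max_eq_left hr] at hnj
        right
        by_contra hle
        have h1 := (hS.1 j (hBm j hj).1).1
        have h2 := (hx i hi).1.2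
        exact (hx i hi).2 (hrun j (hBm j hj).1 ⟨not_lt.1 hle, by linarith⟩)
    refine sum_length_le_two_mul_volume B S.start (fun i => (I.job i).proc) x O
      (fun i _ => (I.job i).proc_pos) (fun i hi => hrun i (hBm i hi).1)
      (fun i hi => ⟨(hx i hi).2, ?_⟩)
      fun i hi j hj hij => ?_
    · refine le_trans ?_ (hx i hi).1.1
      have := (hS.1 i (hBm i hi).1).2
      unfold latestStart; linarith
    · have hne : urgency I i ≠ urgency I j := fun he =>
        hij (congrArg (fun y => (ofLex y).2) he)
      rcases lt_or_gt_of_ne hne with hlt | hlt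
      · rcases hpair i hi j hj hlt with h | h
        exacts [Or.inl (Or.inl h), Or.inr (Or.inl h)]
      · rcases hpair j hj i hi hlt with h | h
        exacts [Or.inl (Or.inr h), Or.inr (Or.inr h)]
  have hcover : (⋃ j ∈ I.names, runInterval I (doubler I) j) ⊆ O ∪ ⋃ i ∈ B, W i := by
    refine Set.iUnion₂_subset fun j hj y hy => ?_
    obtain ⟨i, hi, hf, hJ, he⟩ := exists_doubler_start_eq hj
    have hyW : y ∈ W i := by
      refine ⟨(le_max_right _ _).trans (he ▸ hy.1), hy.2.trans_le ?_⟩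
      rw [he]; exact hJ
    by_cases hW : W i ⊆ O
    · exact Or.inl (hW hyW)
    · exact Or.inr (Set.mem_biUnion (Finset.mem_filter.2 ⟨hi, hf, hW⟩) hyW)
  have hspan : busyTime I (doubler I) ≤ volume (⋃ j ∈ I.names, runInterval I (doubler I) j) := by
    rw [busyTime, tsum_eq_single 0]
    · exact machineSpan_le_volume I _ 0
    · intro i hi
      simp [machineSpan, doubler, hi.symm]
  calc busyTime I (doubler I) ≤ volume (O ∪ ⋃ i ∈ B, W i) := hspan.trans (measure_mono hcover)
    _ ≤ volume O + ∑ i ∈ B, volume (W i) :=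
        (measure_union_le _ _).trans (by gcongr; exact measure_biUnion_finset_le _ _)
    _ = volume O + 2 * ∑ i ∈ B, ENNReal.ofReal (I.job i).proc := by
        rw [Finset.mul_sum]
        congr 1
        refine Finset.sum_congr rfl fun i _ => ?_
        rw [Real.volume_Ico, add_sub_cancel_left, ENNReal.ofReal_mul zero_le_two,
          ENNReal.ofReal_ofNat]
    _ ≤ volume O + 2 * (2 * volume O) := by gcongr
    _ = 5 * volume O := by ring
    _ ≤ 5 * busyTime I S := by gcongr; exact volume_biUnion_runInterval_le_busyTime I S

theorem doubler_isCompetitive : IsCompetitive ⊤ (fun _ => 0) 5 doubler := by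
  refine ⟨doubler_isOnline, fun I => ⟨doubler_feasible I, ?_⟩⟩
  exact le_mul_OPT (by norm_num) (by norm_num) (busyTime_doubler_le I)

/-! ### First fit by size classes for rigid jobs -/

theorem proc_le_pmax {I : Instance} {j : ℕ} (hj : j ∈ I.names) : (I.job j).proc ≤ pmax I :=
  le_csSup (I.names.finite_toSet.image _).bddAbove ⟨j, hj, rfl⟩

/-- The upper end of the size class of job `j`: the classes are the intervals
`(p_max / 2 ^ (k + 1), p_max / 2 ^ k]`. -/
def sizeClass (I : Instance) (j : ℕ) : ℝ :=
  pmax I / 2 ^ Nat.log 2 ⌊pmax I / (I.job j).proc⌋₊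

theorem proc_le_sizeClass {I : Instance} {j : ℕ} (hj : j ∈ I.names) :
    (I.job j).proc ≤ sizeClass I j := by
  have hp := (I.job j).proc_pos
  have h1 : 1 ≤ pmax I / (I.job j).proc := (one_le_div hp).2 (proc_le_pmax hj)
  have h2 : ((2 ^ Nat.log 2 ⌊pmax I / (I.job j).proc⌋₊ : ℕ) : ℝ) ≤ pmax I / (I.job j).proc :=
    (Nat.le_floor_iff (by linarith)).1
      (Nat.pow_log_le_self 2 ((Nat.floor_pos.2 h1).ne'))
  push_cast at h2
  rw [le_div_iff₀ hp] at h2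
  rw [sizeClass, le_div_iff₀ (by positivity)]
  linarith

theorem sizeClass_lt {I : Instance} {j : ℕ} (hj : j ∈ I.names) :
    sizeClass I j < 2 * (I.job j).proc := by
  have hp := (I.job j).proc_pos
  have h1 : 0 ≤ pmax I / (I.job j).proc := div_nonneg (hp.le.trans (proc_le_pmax hj)) hp.le
  have h2 := (Nat.floor_lt h1).1
    (Nat.lt_pow_succ_log_self one_lt_two ⌊pmax I / (I.job j).proc⌋₊)
  push_cast at h2
  rw [div_lt_iff₀ hp, pow_succ] at h2
  rw [sizeClass, div_lt_iff₀ (by positivity)]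
  linarith

theorem sizeClass_le_pmax {I : Instance} {j : ℕ} (hj : j ∈ I.names) : sizeClass I j ≤ pmax I :=
  div_le_self ((I.job j).proc_pos.le.trans (proc_le_pmax hj)) (one_le_pow₀ one_le_two)

theorem two_mul_sizeClass_le {I : Instance} {i j : ℕ} (hj : j ∈ I.names)
    (h : sizeClass I j < sizeClass I i) : 2 * sizeClass I j ≤ sizeClass I i := by
  have hP : 0 < pmax I := (I.job j).proc_pos.trans_le (proc_le_pmax hj)
  unfold sizeClass at *
  rw [div_lt_div_iff_of_pos_left hP (by positivity) (by positivity)] at h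
  have h1 := (pow_lt_pow_iff_right₀ (one_lt_two (α := ℝ))).1 h
  have h2 := pow_le_pow_right₀ (one_le_two (α := ℝ)) (Nat.succ_le_of_lt h1)
  rw [← mul_div_assoc, div_le_div_iff₀ (by positivity) (by positivity)]
  rw [Nat.succ_eq_add_one, pow_succ] at h2
  nlinarith

/-- The order in which first fit treats the jobs: larger size classes first, inside a class by start
time, ties being broken by names. -/
def priority (I : Instance) (S : Schedule) (j : ℕ) : ℝ ×ₗ ℝ ×ₗ ℕ :=
  toLex (-sizeClass I j, toLex (S.start j, j))

theorem priority_lt {I : Instance} {S : Schedule} {i j : ℕ}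
    (h : priority I S i < priority I S j) :
    sizeClass I j < sizeClass I i ∨ (sizeClass I i = sizeClass I j ∧ S.start i ≤ S.start j) := by
  rcases Prod.Lex.toLex_lt_toLex.1 h with h | ⟨h, h'⟩
  · exact Or.inl (neg_lt_neg_iff.1 h)
  · refine Or.inr ⟨neg_injective h, ?_⟩
    rcases Prod.Lex.toLex_lt_toLex.1 h' with h' | h'
    · exact h'.le
    · exact h'.1.le

theorem priority_injective (I : Instance) (S : Schedule) : Function.Injective (priority I S) :=
  fun _ _ h => congrArg (fun y => (ofLex (ofLex y).2).2) h

/-- Two jobs overlap if they run simultaneously at some time. -/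
def Overlap (I : Instance) (S : Schedule) (i j : ℕ) : Prop :=
  S.start i < S.start j + (I.job j).proc ∧ S.start j < S.start i + (I.job i).proc

/-- First fit onto tracks, that is, sets of pairwise disjoint jobs: in the order of priority, each
job is put on the first track where it overlaps no job treated before. -/
def track (I : Instance) (S : Schedule) : ℕ → ℕ :=
  (wellFounded_earlier I.names (priority I S)).fix fun j tr =>
    sInf {n | ∀ i (h : Earlier I.names (priority I S) i j), Overlap I S i j → tr i h ≠ n}

theorem track_eq (I : Instance) (S : Schedule) (j : ℕ) :
    track I S j = sInf {n | ∀ i, Earlier I.names (priority I S) i j → Overlap I S i j →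
      track I S i ≠ n} := by
  conv_lhs => rw [track, WellFounded.fix_eq]
  rfl

theorem track_ne {I : Instance} {S : Schedule} {i j : ℕ}
    (h : Earlier I.names (priority I S) i j) (ho : Overlap I S i j) :
    track I S i ≠ track I S j := by
  classical
  obtain ⟨n, hn⟩ := Infinite.exists_notMem_finset (I.names.image (track I S))
  have := Nat.sInf_mem (s := {n | ∀ i, Earlier I.names (priority I S) i j → Overlap I S i j →
      track I S i ≠ n}) ⟨n, fun i hi _ he => hn (he ▸ Finset.mem_image_of_mem _ hi.1)⟩
  rw [← track_eq] at this
  exact this i h ho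

theorem exists_overlap_of_lt_track {I : Instance} {S : Schedule} {j n : ℕ}
    (h : n < track I S j) :
    ∃ i, Earlier I.names (priority I S) i j ∧ Overlap I S i j ∧ track I S i = n := by
  rw [track_eq] at h
  have := Nat.notMem_of_lt_sInf h
  simp only [Set.mem_ofPred_eq] at this
  push Not at this
  exact this

/-- A job treated after `i` is less than twice as long as `i`, and shorter than `i` if it starts
before `i`, because it then belongs to a smaller size class. -/
theorem runInterval_subset_of_overlap {I : Instance} {S : Schedule} {i j : ℕ} (hj : j ∈ I.names)
    (h : Earlier I.names (priority I S) i j) (ho : Overlap I S i j) :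
    runInterval I S j ⊆
      Set.Ico (S.start i - (I.job i).proc) (S.start i + 3 * (I.job i).proc) := by
  obtain ⟨ho1, ho2⟩ := ho
  have hpi := (I.job i).proc_pos
  have h1 := proc_le_sizeClass hj
  have h2 := sizeClass_lt h.1
  intro y hy
  obtain ⟨hy1, hy2⟩ := hy
  rcases priority_lt h.2 with hlt | ⟨heq, hs⟩
  · have h3 := two_mul_sizeClass_le hj hlt
    constructor <;> linarith
  · constructor <;> linarith

/-- The track of `j` is determined by the jobs that start up to time `S.start j + p_max - b`, where
`b` is the size class of `j`: a job of a larger class has class at least `2 * b`, and it starts at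
most `b` later than `j` if it overlaps `j`. -/
theorem track_congr {I I' : Instance} {S S' : Schedule} {T : ℝ} (hP : pmax I' = pmax I)
    (h : ∀ i ∈ I.names, S.start i ≤ T →
      i ∈ I'.names ∧ I'.job i = I.job i ∧ S'.start i = S.start i)
    (h' : ∀ i ∈ I'.names, S'.start i ≤ T →
      i ∈ I.names ∧ I.job i = I'.job i ∧ S.start i = S'.start i)
    (j : ℕ) (hj : j ∈ I.names) (hT : S.start j + pmax I - sizeClass I j ≤ T) :
    track I S j = track I' S' j := by
  have hle : ∀ i ∈ I.names, S.start i + pmax I - sizeClass I i ≤ T → S.start i ≤ T :=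
    fun i hi hiT => by linarith [sizeClass_le_pmax hi]
  have hclass : ∀ i, I'.job i = I.job i → sizeClass I' i = sizeClass I i := fun i hi => by
    rw [sizeClass, sizeClass, hP, hi]
  induction j using (wellFounded_earlier I.names (priority I S)).induction with
  | _ j ih =>
    obtain ⟨hj', hjob, hstart⟩ := h j hj (hle j hj hT)
    have hreach : ∀ i ∈ I.names, priority I S i < priority I S j → Overlap I S i j →
        S.start i + pmax I - sizeClass I i ≤ T := by
      intro i _ hlt ho
      rcases priority_lt hlt with hlt | ⟨heq, hs⟩
      · have h1 := two_mul_sizeClass_le hj hlt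
        have h2 := proc_le_sizeClass hj
        have h3 := ho.1
        linarith
      · linarith
    rw [track_eq, track_eq]
    congr 1
    ext n
    refine forall_congr' fun i => ?_
    have hE : Earlier I.names (priority I S) i j ∧ Overlap I S i j ↔
        Earlier I'.names (priority I' S') i j ∧ Overlap I' S' i j := by
      constructor
      · rintro ⟨⟨hi, hlt⟩, ho⟩
        obtain ⟨hi', hijob, histart⟩ := h i hi (hle i hi (hreach i hi hlt ho))
        refine ⟨⟨hi', ?_⟩, ?_⟩
        · simpa only [priority, hclass i hijob, hclass j hjob, histart, hstart] using hlt
        · simpa only [Overlap, hijob, hjob, histart, hstart] using ho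
      · rintro ⟨⟨hi', hlt⟩, ho⟩
        have hiT : S'.start i ≤ T := by
          have h1 := ho.1
          rw [hstart, hjob] at h1
          have h2 := proc_le_sizeClass hj
          have h3 := sizeClass_le_pmax hj
          rcases priority_lt hlt with hlt | ⟨heq, hs⟩
          · have h4 := two_mul_sizeClass_le hj' hlt
            have h5 := sizeClass_le_pmax hi'
            rw [hclass j hjob] at h4
            linarith
          · linarith
        obtain ⟨hi, hijob, histart⟩ := h' i hi' hiT
        refine ⟨⟨hi, ?_⟩, ?_⟩
        · simpa only [priority, hclass i hijob.symm, hclass j hjob, ← histart, hstart] using hlt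
        · simpa only [Overlap, ← hijob, hjob, ← histart, hstart] using ho
    have htrack : Earlier I.names (priority I S) i j → Overlap I S i j →
        track I S i = track I' S' i := fun hi ho =>
      ih i hi hi.1 (hreach i hi.1 hi.2 ho)
    constructor
    · intro H hi ho
      obtain ⟨hi, ho⟩ := hE.2 ⟨hi, ho⟩
      rw [← htrack hi ho]; exact H hi ho
    · intro H hi ho
      rw [htrack hi ho]; exact H (hE.1 ⟨hi, ho⟩).1 (hE.1 ⟨hi, ho⟩).2

/-! ### Bundles of `g` tracks -/

/-- The schedule with the start times of `S` in which each machine receives `g` consecutive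
tracks. -/
def bundle (g : ℕ) (I : Instance) (S : Schedule) : Schedule where
  start := S.start
  machine j := track I S j / g

theorem bundle_feasible {g : ℕ} (hg : 1 ≤ g) {I : Instance} {S : Schedule}
    (hS : Feasible ⊤ I S) : Feasible g I (bundle g I S) := by
  classical
  refine ⟨hS.1, fun m t => ?_⟩
  have hinj : Set.InjOn (track I S)
      {j | j ∈ I.names ∧ (bundle g I S).machine j = m ∧ t ∈ runInterval I (bundle g I S) j} := by
    rintro i ⟨hi, -, hit⟩ j ⟨hj, -, hjt⟩ he
    by_contra hij
    have ho : Overlap I S i j := ⟨hit.1.trans_lt hjt.2, hjt.1.trans_lt hit.2⟩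
    rcases lt_or_gt_of_ne ((priority_injective I S).ne hij) with hlt | hlt
    · exact track_ne ⟨hi, hlt⟩ ho he
    · exact track_ne ⟨hj, hlt⟩ ho.symm he.symm
  rw [← hinj.encard_image]
  have hsub : track I S '' {j | j ∈ I.names ∧ (bundle g I S).machine j = m ∧
      t ∈ runInterval I (bundle g I S) j} ⊆ (Finset.Ico (m * g) (m * g + g) : Finset ℕ) := by
    rintro _ ⟨j, ⟨-, hm, -⟩, rfl⟩
    have hm : track I S j / g = m := hm
    rw [Finset.coe_Ico, Set.mem_Ico, ← hm]
    have h1 := Nat.div_add_mod' (track I S j) g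
    have h2 := Nat.mod_lt (track I S j) hg
    omega
  refine (Set.encard_le_encard hsub).trans ?_
  rw [Set.encard_coe_eq_coe_finsetCard]
  simp

theorem machineSpan_bundle_succ_le {g : ℕ} (I : Instance) (S : Schedule) (m q : ℕ)
    (hq : q < g) :
    machineSpan I (bundle g I S) (m + 1) ≤
      4 * ∑ i ∈ I.names with track I S i = m * g + q, ENNReal.ofReal (I.job i).proc := by
  have hsub : (⋃ j ∈ {j | j ∈ I.names ∧ (bundle g I S).machine j = m + 1},
      runInterval I (bundle g I S) j) ⊆ ⋃ i ∈ I.names.filter (track I S · = m * g + q),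
        Set.Ico (S.start i - (I.job i).proc) (S.start i + 3 * (I.job i).proc) := by
    refine Set.iUnion₂_subset fun j ⟨hj, hm⟩ => ?_
    have hm : track I S j / g = m + 1 := hm
    have hlt : m * g + q < track I S j := by
      have h1 := Nat.div_add_mod' (track I S j) g
      rw [hm, add_mul, one_mul] at h1
      omega
    obtain ⟨i, hi, ho, hn⟩ := exists_overlap_of_lt_track hlt
    exact (runInterval_subset_of_overlap hj hi ho).trans
      (Set.subset_biUnion_of_mem (u := fun i =>
        Set.Ico (S.start i - (I.job i).proc) (S.start i + 3 * (I.job i).proc))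
        (Finset.mem_filter.2 ⟨hi.1, hn⟩))
  refine (measure_mono hsub).trans ((measure_biUnion_finset_le _ _).trans_eq ?_)
  rw [Finset.mul_sum]
  refine Finset.sum_congr rfl fun i _ => ?_
  rw [Real.volume_Ico, show S.start i + 3 * (I.job i).proc - (S.start i - (I.job i).proc) =
    4 * (I.job i).proc by ring, ENNReal.ofReal_mul zero_le_four, ENNReal.ofReal_ofNat]

theorem mul_machineSpan_bundle_succ_le {g : ℕ} (hg : 1 ≤ g) (I : Instance) (S : Schedule)
    (m : ℕ) :
    g * machineSpan I (bundle g I S) (m + 1) ≤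
      4 * ∑ i ∈ I.names with track I S i / g = m, ENNReal.ofReal (I.job i).proc := by
  classical
  calc g * machineSpan I (bundle g I S) (m + 1)
      = ∑ _q ∈ Finset.range g, machineSpan I (bundle g I S) (m + 1) := by simp
    _ ≤ ∑ q ∈ Finset.range g,
          4 * ∑ i ∈ I.names with track I S i = m * g + q, ENNReal.ofReal (I.job i).proc :=
        Finset.sum_le_sum fun q hq =>
          machineSpan_bundle_succ_le I S m q (Finset.mem_range.1 hq)
    _ = 4 * ∑ i ∈ I.names with track I S i / g = m, ENNReal.ofReal (I.job i).proc := by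
        rw [← Finset.mul_sum, ← Finset.sum_fiberwise_of_maps_to
          (s := {i ∈ I.names | track I S i / g = m}) (t := Finset.range g)
          (g := fun i => track I S i % g) fun i _ => Finset.mem_range.2 (Nat.mod_lt _ hg)]
        congr 1
        refine Finset.sum_congr rfl fun q hq => ?_
        rw [Finset.filter_filter]
        refine Finset.sum_congr (Finset.filter_congr fun i _ => ?_) fun _ _ => rfl
        have hq := Finset.mem_range.1 hq
        constructor
        · intro h
          rw [h, add_comm, Nat.add_mul_div_right _ _ hg, Nat.add_mul_mod_self_right,
            Nat.div_eq_of_lt hq, Nat.mod_eq_of_lt hq]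
          simp
        · rintro ⟨h1, h2⟩
          rw [← h1, ← h2, Nat.div_add_mod']

theorem tsum_machineSpan_bundle_succ_le {g : ℕ} (hg : 1 ≤ g) (I : Instance) (S : Schedule) :
    ∑' m, machineSpan I (bundle g I S) (m + 1) ≤ 4 * OPT g I := by
  have hg0 : (g : ℝ≥0∞) ≠ 0 := by exact_mod_cast (Nat.pos_of_ne_zero (by omega)).ne'
  rw [← ENNReal.mul_le_mul_iff_right hg0 (ENNReal.natCast_ne_top g), ← ENNReal.tsum_mul_left]
  calc ∑' m, g * machineSpan I (bundle g I S) (m + 1)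
      ≤ ∑' m, 4 * ∑ i ∈ I.names with track I S i / g = m, ENNReal.ofReal (I.job i).proc :=
        ENNReal.tsum_le_tsum (mul_machineSpan_bundle_succ_le hg I S)
    _ = 4 * ∑ i ∈ I.names, ENNReal.ofReal (I.job i).proc := by
        rw [ENNReal.tsum_mul_left, tsum_sum_filter_eq]
    _ ≤ 4 * (g * OPT g I) := by gcongr; exact sum_proc_le_mul_OPT hg I
    _ = g * (4 * OPT g I) := by ring

/-- With lookahead `p_max`, all jobs that an online algorithm without lookahead starts up to time
`t + p_max` are known at time `t`, and they determine the tracks of the jobs started up to `t`. -/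
theorem bundle_isOnline (g : ℕ) {F : Instance → Schedule} (hF : IsOnline (fun _ => 0) F)
    (hfeas : ∀ I, Feasible ⊤ I (F I)) : IsOnline pmax fun I => bundle g I (F I) := by
  intro I I' t h j hj ht
  have ht : (F I).start j ≤ t := ht
  have hrel : (I.job j).release ≤ t := ((hfeas I).1 j hj).1.trans ht
  have hpos : 0 < pmax I := (I.job j).proc_pos.trans_le (proc_le_pmax hj)
  obtain ⟨hj', hjob, hP⟩ := mem_of_history_eq h hj (by linarith)
  have hsub : ∀ {I I' : Instance}, pmax I' = pmax I →
      history (pmax I) I t = history (pmax I') I' t →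
      history 0 I (t + pmax I) ⊆ history 0 I' (t + pmax I) := by
    rintro I I' hP h _ ⟨hx, i, hi, rfl⟩
    have hx : (I.job i).release - 0 ≤ t + pmax I := hx
    obtain ⟨hi', hijob, -⟩ := mem_of_history_eq h hi (by linarith)
    exact ⟨hx, i, hi', by rw [hijob]⟩
  have h0 : history 0 I (t + pmax I) = history 0 I' (t + pmax I) :=
    (hsub hP h).antisymm (by have := hsub hP.symm h.symm; rwa [hP] at this)
  have hagree : ∀ {I I' : Instance} {T : ℝ}, history 0 I T = history 0 I' T →
      ∀ i ∈ I.names, (F I).start i ≤ T →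
        i ∈ I'.names ∧ I'.job i = I.job i ∧ (F I').start i = (F I).start i := by
    intro I I' T h i hi hiT
    obtain ⟨hi', hijob, -⟩ := mem_of_history_eq h hi
      (by linarith [((hfeas I).1 i hi).1])
    exact ⟨hi', hijob, (hF I I' T h i hi hiT).1⟩
  refine ⟨(hagree h0 j hj (by linarith)).2.2, ?_⟩
  have hclass := (I.job j).proc_pos.trans_le (proc_le_sizeClass hj)
  exact congrArg (· / g)
    (track_congr hP (hagree h0) (hagree h0.symm) j hj (by linarith)).symm

theorem machineSpan_bundle_le {c : ℝ≥0∞} (g : ℕ) {I : Instance} {S : Schedule}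
    (hS : busyTime I S ≤ c) (m : ℕ) : machineSpan I (bundle g I S) m ≤ c :=
  (machineSpan_le_volume I _ m).trans
    ((volume_biUnion_runInterval_le_busyTime I S).trans hS)

theorem bundle_isCompetitive {g : ℕ} (hg : 1 ≤ g) {F : Instance → Schedule}
    (hF : IsCompetitive ⊤ (fun _ => 0) 5 F) :
    IsCompetitive g pmax 9 fun I => bundle g I (F I) := by
  refine ⟨bundle_isOnline g hF.1 fun I => (hF.2 I).1, fun I =>
    ⟨bundle_feasible hg (hF.2 I).1, ?_⟩⟩
  rw [busyTime, tsum_eq_zero_add' ENNReal.summable]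
  calc _ ≤ 5 * OPT ⊤ I + 4 * OPT g I :=
        add_le_add (machineSpan_bundle_le g (hF.2 I).2 0)
          (tsum_machineSpan_bundle_succ_le hg I (F I))
    _ ≤ 5 * OPT g I + 4 * OPT g I := by gcongr; exact OPT_top_le g I
    _ = 9 * OPT g I := by ring

end BusyTime

end

theorem mainTheorem4 (g : ℕ) (hg : 1 ≤ g) :
    (∃ A : BusyTime.Instance → BusyTime.Schedule,
      BusyTime.IsCompetitive (g : ℕ∞) BusyTime.pmax 9 A) ∧
    (∃ F : BusyTime.Instance → BusyTime.Schedule,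
      BusyTime.IsCompetitive ⊤ (fun _ => 0) 5 F) ∧
    (∀ F : BusyTime.Instance → BusyTime.Schedule,
      BusyTime.IsCompetitive ⊤ (fun _ => 0) 5 F →
      ∃ A : BusyTime.Instance → BusyTime.Schedule,
        BusyTime.IsCompetitive (g : ℕ∞) BusyTime.pmax 9 A ∧
        ∀ I : BusyTime.Instance,
          (∀ j ∈ I.names, (A I).start j = (F I).start j) ∧
          BusyTime.machineSpan I (A I) 0 ≤ 5 * BusyTime.OPT ⊤ I ∧
          ∑' i : ℕ, BusyTime.machineSpan I (A I) (i + 1) ≤ 4 * BusyTime.OPT (g : ℕ∞) I) :=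
  ⟨⟨_, BusyTime.bundle_isCompetitive hg BusyTime.doubler_isCompetitive⟩,
    ⟨_, BusyTime.doubler_isCompetitive⟩, fun F hF =>
    ⟨_, BusyTime.bundle_isCompetitive hg hF, fun I =>
      ⟨fun _ _ => rfl, BusyTime.machineSpan_bundle_le g (hF.2 I).2 0,
        BusyTime.tsum_machineSpan_bundle_succ_le hg I (F I)⟩⟩⟩
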